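/- Let $y=(y_i)_{i\in V}$ be finitely many discrete variables, $y_i\in X_i$ with $X_i$ finite, and let $\mathcal C$ be a finite set of cliques $c\subseteq V$. Let $S(y)$ be the 0-1 vector whose entries indicate the state of every node, $[y_i=x]$ ($i\in V$, $x\in X_i$), and the joint state of every clique, $[y_c=x_c]$ ($c\in\mathcal C$, $x_c\in\prod_{i\in c}X_i$). Let $\mathcal M=\operatorname{conv}\{S(y)\}$ be the marginal polytope, let $d_i$ be the number of cliques that contain $i$, and let $$H_{\mathcal B}(\mu)=\sum_{c\in\mathcal C}H(\mu_c)-\sum_{i\in V}(d_i-1)H(\mu_i),\qquad H(p)=-\sum_x p(x)\log p(x)\quad(0\log 0=0),$$ be the Bethe entropy. $\mathrm{MARGINAL\text{-}ORACLE}(\theta)$ returns a solution of $\operatorname{argmin}_{\mu\in\mathcal M}\,-H_{\mathcal B}(\mu)-\langle\theta,\mu\rangle$. Given parameters $\theta$, an energy $L_\psi$ and learning rates $\eta_t$, Bethe-MD sets $\mu_0=\mathrm{MARGINAL\text{-}ORACLE}(\theta)$ and, for $t\ge 1$, $$g_t=\nabla H_{\mathcal B}(\mu_{t-1})+\eta_t\nabla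 L_\psi(\mu_{t-1}),\qquad \mu_t=\mathrm{MARGINAL\text{-}ORACLE}\Bigl(\tfrac{1}{1+\eta_t}(\eta_t\theta-g_t)\Bigr).$$ **Proposition.** Assume that $-H_{\mathcal B}$ is convex on $\mathcal M$. For all $\Lambda\ge 0$ and $\delta>0$ there is $\eta_{\max}>0$ (depending only on the graphical model $(X_i)_i,\mathcal C$ and on $\Lambda,\delta$) such that the following holds for every $\theta$, every energy $L_\psi$ that is differentiable at the points of $\mathcal M$ with $\Lambda$-Lipschitz gradient on $\mathcal M$ (but is possibly non-convex), and all learning rates with $0<\eta_t\le\eta_{\max}$ for $t\ge1$ and $\sum_{t\ge 1}\eta_t=\infty$ (for instance constant ones). If the iterates $\mu_t$ of Bethe-MD all stay at Euclidean distance at least $\delta$ from the relative boundary of $\mathcal M$, then they satisfy the asymptotic stationary point condition for the objective $$F(\mu)=-H_{\mathcal B}(\mu)-\langle\theta,\mu\rangle+L_\psi(\mu)$$ along the affine hull of $\mathcal M$: $F$ is differentiable at every $\mu_t$, and $$\lim_{t\to\infty}\bigl\|P\,\nabla F(\mu_t)\bigr\|_2=0,$$ where $P$ is the orthogonal projection onto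 the direction space of the affine hull of $\mathcal M$ (so that $P\nabla F$ is the gradient of $F$ restricted to that affine hull). -/

import Mathlib

open scoped NNReal

noncomputable section

namespace BetheMD

variable {V : Type*} [Fintype V] [DecidableEq V]
variable {X : V → Type*} [∀ i, Fintype (X i)] [∀ i, DecidableEq (X i)]

/-- Coordinates of the concatenated vector of node and clique marginals: one coordinate for every
state of every node, and one for every joint state of every clique. -/
abbrev Idx (X : V → Type*) (𝒞 : Finset (Finset V)) : Type _ :=
  (Σ i : V, X i) ⊕ (Σ c : {c : Finset V // c ∈ 𝒞}, ((i : {i : V // i ∈ c.1}) → X i.1))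

/-- The Euclidean space of (pseudo-)marginal vectors and of parameter vectors. -/
abbrev Vec (X : V → Type*) (𝒞 : Finset (Finset V)) : Type _ :=
  EuclideanSpace ℝ (Idx X 𝒞)

/-- The 0-1 vector of sufficient statistics of a joint configuration `y`. -/
def suffStat (𝒞 : Finset (Finset V)) (y : (i : V) → X i) : Vec X 𝒞 :=
  WithLp.toLp 2 (Sum.elim
    (fun p => if y p.1 = p.2 then 1 else 0)
    (fun p => if (∀ i : {i : V // i ∈ p.1.1}, y i.1 = p.2 i) then 1 else 0))

/-- The marginal polytope: all vectors of expected sufficient statistics, i.e. the convex hull of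
the sufficient statistics of the joint configurations. -/
def marginalPolytope (X : V → Type*) [∀ i, Fintype (X i)] [∀ i, DecidableEq (X i)]
    (𝒞 : Finset (Finset V)) : Set (Vec X 𝒞) :=
  convexHull ℝ (Set.range (suffStat (X := X) 𝒞))

/-- The number of cliques that contain node `i`. -/
def cliqueDegree (𝒞 : Finset (Finset V)) (i : V) : ℕ :=
  (𝒞.filter (fun c => i ∈ c)).card

/-- The Bethe entropy `∑_c H(μ_c) - ∑_i (d_i - 1) H(μ_i)`, where `H(p) = -∑ p log p`
and `0 log 0 = 0`. -/
def betheEntropy (𝒞 : Finset (Finset V)) (μ : Vec X 𝒞) : ℝ :=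
  (∑ c : {c : Finset V // c ∈ 𝒞}, ∑ x : ((i : {i : V // i ∈ c.1}) → X i.1),
      Real.negMulLog (μ (Sum.inr ⟨c, x⟩)))
    - ∑ i : V, ((cliqueDegree 𝒞 i : ℝ) - 1) *
        ∑ x : X i, Real.negMulLog (μ (Sum.inl ⟨i, x⟩))

/-- `μ` is an output of the marginal oracle at parameters `θ`: it solves the variational problem
`argmin_{μ ∈ M} -H_B(μ) - ⟨θ, μ⟩` of marginal inference. -/
def IsMarginalOracle (𝒞 : Finset (Finset V)) (θ μ : Vec X 𝒞) : Prop :=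
  μ ∈ marginalPolytope X 𝒞 ∧
    IsMinOn (fun ν => -betheEntropy 𝒞 ν - inner ℝ θ ν) (marginalPolytope X 𝒞) μ

/-- `μ 0, μ 1, …` is a run of the algorithm Bethe-MD with parameters `θ`, energy `L` and learning
rates `η 1, η 2, …` (`η 0` is not used). -/
structure IsBetheMD (𝒞 : Finset (Finset V)) (θ : Vec X 𝒞) (L : Vec X 𝒞 → ℝ) (η : ℕ → ℝ)
    (μ : ℕ → Vec X 𝒞) : Prop where
  init : IsMarginalOracle 𝒞 θ (μ 0)
  step : ∀ t : ℕ, IsMarginalOracle 𝒞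
    ((1 / (1 + η (t + 1))) • (η (t + 1) • θ -
      (gradient (betheEntropy 𝒞) (μ t) + η (t + 1) • gradient L (μ t)))) (μ (t + 1))

/-- The objective `-H_B(μ) - ⟨θ, μ⟩ + L(μ)` of non-local marginal inference. -/
def objective (𝒞 : Finset (Finset V)) (θ : Vec X 𝒞) (L : Vec X 𝒞 → ℝ) (μ : Vec X 𝒞) : ℝ :=
  -betheEntropy 𝒞 μ - inner ℝ θ μ + L μ

/-- The gradient of `f` along the affine hull of `M`: the orthogonal projection of the gradient to
the direction space of the affine hull (for `f` differentiable at `x` in the affine hull, this is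
the gradient of the restriction of `f` to the affine hull). -/
def gradientAlong {ι : Type*} [Fintype ι] (M : Set (EuclideanSpace ℝ ι))
    (f : EuclideanSpace ℝ ι → ℝ) (x : EuclideanSpace ℝ ι) : EuclideanSpace ℝ ι :=
  (affineSpan ℝ M).direction.starProjection (gradient f x)

/-- The asymptotic stationary point condition for `f` along the affine hull of `M`: `f` is
differentiable at the points of the sequence and `‖∇f(x_n)‖₂ → 0`. -/
def AsymptoticStationary {ι : Type*} [Fintype ι] (M : Set (EuclideanSpace ℝ ι))
    (f : EuclideanSpace ℝ ι → ℝ) (x : ℕ → EuclideanSpace ℝ ι) : Prop :=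
  (∀ n, DifferentiableAt ℝ f (x n)) ∧
    Filter.Tendsto (fun n => ‖gradientAlong M f (x n)‖) Filter.atTop (nhds 0)

end BetheMD

end

/-! Bethe-MD is mirror descent with mirror map `f = -H_B`. Off the relative boundary, the optimality
condition of the oracle reads `P((1+η)(∇f(μ⁺) - ∇f(μ)) + η∇F(μ)) = 0`. If `f` is `σ`-strongly convex
along the affine hull and smooth where the iterates live, a small `η` makes `F` drop by at least a
constant times `η‖P∇F(μ)‖²`, while `P∇F` moves by at most a constant times `η‖P∇F(μ)‖`. Hence `∑
η_t‖P∇F(μ_t)‖²` converges, `‖P∇F(μ_t)‖²` is Cauchy, and a nonzero limit would contradict `∑ η_t =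
∞`. Convexity of the energy plays no role (`tendsto_gradient_of_mirrorDescent`).

The main point is that mere convexity of `-H_B` on the polytope forces strong convexity away from
the boundary. Testing convexity at midpoints of two vertices gives a counting inequality on node
degrees, which is Hall's condition for assigning to each node `d_i - 1` of its cliques, no clique
being used twice (`exists_matching`). Along a matching, the Hessian form becomes a sum of
nonnegative terms, because a clique's form dominates that of each of its nodes; the equality cases
leave only the zero direction (`eq_zero_of_betheQuad_nonpos`). Compactness then gives a uniform `σ`
(`exists_mul_norm_sq_le_betheQuad`). -/

set_option linter.unusedSectionVars false

noncomputable section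

namespace BetheMD

/-! ### Mirror descent with a strongly convex, smooth mirror map -/

section MirrorDescent

variable {E : Type*} [NormedAddCommGroup E] [InnerProductSpace ℝ E] [CompleteSpace E]

lemma _root_.HasGradientAt.hasDerivAt_lineMap {f : E → ℝ} {g x v : E} {s : ℝ}
    (h : HasGradientAt f g (x + s • v)) :
    HasDerivAt (fun r : ℝ => f (x + r • v)) (inner ℝ g v) s := by
  have h1 : HasDerivAt (fun r : ℝ => x + r • v) v s := by
    simpa using ((hasDerivAt_id s).smul_const v).const_add x
  have h2 := h.hasFDerivAt.comp_hasDerivAt s h1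
  rw [InnerProductSpace.toDual_apply_apply] at h2
  exact h2

/-- The mean value theorem along a segment, in terms of the gradient. -/
lemma exists_gradient_eq_sub {K : Set E} (hK : Convex ℝ K) {f : E → ℝ} {f' : E → E}
    (hf : ∀ z ∈ K, HasGradientAt f (f' z) z) {x y : E} (hx : x ∈ K) (hy : y ∈ K) :
    ∃ s ∈ Set.Ioo (0 : ℝ) 1, x + s • (y - x) ∈ K ∧
      f y - f x = inner ℝ (f' (x + s • (y - x))) (y - x) := by
  have hmem : ∀ s ∈ Set.Icc (0 : ℝ) 1, x + s • (y - x) ∈ K := fun s hs =>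
    hK.add_smul_sub_mem hx hy hs
  have hd : ∀ s ∈ Set.Icc (0 : ℝ) 1, HasDerivAt (fun r : ℝ => f (x + r • (y - x)))
      (inner ℝ (f' (x + s • (y - x))) (y - x)) s := fun s hs =>
    (hf _ (hmem s hs)).hasDerivAt_lineMap
  obtain ⟨s, hs, h⟩ := exists_hasDerivAt_eq_slope (fun r : ℝ => f (x + r • (y - x))) _ one_pos
    (fun s hs => (hd s hs).continuousAt.continuousWithinAt)
    (fun s hs => hd s (Set.Ioo_subset_Icc_self hs))
  refine ⟨s, hs, hmem s (Set.Ioo_subset_Icc_self hs), ?_⟩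
  simpa using h.symm

/-- The gradient inequality of a function with monotone gradient. -/
lemma sub_le_inner_of_monotone_gradient {K : Set E} (hK : Convex ℝ K) {f : E → ℝ} {f' : E → E}
    (hf : ∀ z ∈ K, HasGradientAt f (f' z) z)
    (hmono : ∀ x ∈ K, ∀ y ∈ K, 0 ≤ inner ℝ (f' x - f' y) (x - y))
    {x y : E} (hx : x ∈ K) (hy : y ∈ K) :
    f y - f x ≤ inner ℝ (f' y) (y - x) := by
  obtain ⟨s, hs, hz, h⟩ := exists_gradient_eq_sub hK hf hx hy
  have h1 := hmono y hy _ hz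
  -- `y - z` is a positive multiple of `y - x`, so monotonicity between `y` and the mean value point
  -- `z` compares the slopes in direction `y - x`.
  have h2 : y - (x + s • (y - x)) = (1 - s) • (y - x) := by module
  rw [h2, inner_smul_right, inner_sub_left] at h1
  have h3 := nonneg_of_mul_nonneg_right h1 (by linarith [hs.2] : 0 < 1 - s)
  linarith

/-- The descent inequality of a function with Lipschitz gradient. -/
lemma sub_le_inner_add_of_lipschitz_gradient {K : Set E} (hK : Convex ℝ K) {f : E → ℝ}
    {f' : E → E} {Λ : ℝ} (hΛ : 0 ≤ Λ) (hf : ∀ z ∈ K, HasGradientAt f (f' z) z)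
    (hlip : ∀ x ∈ K, ∀ y ∈ K, ‖f' x - f' y‖ ≤ Λ * ‖x - y‖)
    {x y : E} (hx : x ∈ K) (hy : y ∈ K) :
    f y - f x ≤ inner ℝ (f' x) (y - x) + Λ * ‖y - x‖ ^ 2 := by
  obtain ⟨s, hs, hz, h⟩ := exists_gradient_eq_sub hK hf hx hy
  have h1 := hlip _ hz x hx
  have h2 := real_inner_le_norm (f' (x + s • (y - x)) - f' x) (y - x)
  rw [inner_sub_left] at h2
  rw [add_sub_cancel_left, norm_smul, Real.norm_of_nonneg hs.1.le] at h1
  have h3 : s * ‖y - x‖ ≤ ‖y - x‖ := mul_le_of_le_one_left (norm_nonneg _) hs.2.le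
  have h4 : ‖f' (x + s • (y - x)) - f' x‖ * ‖y - x‖ ≤ Λ * ‖y - x‖ * ‖y - x‖ := by
    gcongr
    exact h1.trans (by gcongr)
  nlinarith

/-- A nonnegative sequence whose increments are controlled by `η t * u t`, which is summable while
`η` is not, tends to zero. -/
lemma tendsto_zero_of_summable_mul {u η : ℕ → ℝ} {C : ℝ} (hu : ∀ t, 0 ≤ u t) (hη : ∀ t, 0 ≤ η t)
    (hsum : Summable fun t => η t * u t) (hinc : ∀ t, |u (t + 1) - u t| ≤ C * (η t * u t))
    (hdiv : ¬ Summable η) : Filter.Tendsto u Filter.atTop (nhds 0) := by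
  have hc : CauchySeq u := by
    refine cauchySeq_of_summable_dist ?_
    refine (hsum.mul_left C).of_nonneg_of_le (fun _ => dist_nonneg) fun t => ?_
    rw [dist_comm, Real.dist_eq]
    exact hinc t
  obtain ⟨l, hl⟩ := cauchySeq_tendsto_of_complete hc
  have hl0 : 0 ≤ l := ge_of_tendsto' hl hu
  rcases hl0.eq_or_lt with rfl | hpos
  · exact hl
  refine absurd ?_ hdiv
  -- If the limit `l` were positive, then eventually `u t > l / 2`, and `η` would be dominated by
  -- `(2 / l) * (η t * u t)`.
  refine Summable.of_norm_bounded_eventually_nat (hsum.mul_left (2 / l)) ?_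
  filter_upwards [hl.eventually (lt_mem_nhds (half_lt_self hpos))] with t ht
  rw [Real.norm_of_nonneg (hη t)]
  have h1 : η t * (l / 2) ≤ η t * u t := mul_le_mul_of_nonneg_left ht.le (hη t)
  calc η t = 2 / l * (η t * (l / 2)) := by field_simp
    _ ≤ _ := by gcongr

variable {K : Set E} {D : Submodule ℝ E} [D.HasOrthogonalProjection] {f L : E → ℝ} {f' L' : E → E}
  {σ ℓ Λ : ℝ}

/-- One step of mirror descent: sufficient decrease, and slow variation of the gradient. -/
lemma mirrorDescent_step (hK : Convex ℝ K) (hσ : 0 < σ) (hℓ : 0 < ℓ) (hΛ : 0 ≤ Λ)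
    (hf : ∀ z ∈ K, HasGradientAt f (f' z) z) (hL : ∀ z ∈ K, HasGradientAt L (L' z) z)
    (hmono : ∀ x ∈ K, ∀ y ∈ K, σ * ‖x - y‖ ^ 2 ≤ inner ℝ (f' x - f' y) (x - y))
    (hflip : ∀ x ∈ K, ∀ y ∈ K, ‖f' x - f' y‖ ≤ ℓ * ‖x - y‖)
    (hLlip : ∀ x ∈ K, ∀ y ∈ K, ‖L' x - L' y‖ ≤ Λ * ‖x - y‖)
    {x y : E} (hx : x ∈ K) (hy : y ∈ K) (hxy : y - x ∈ D) {η : ℝ} (hη : 0 < η) (hη1 : η ≤ 1)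
    (hηΛ : Λ * η ≤ σ / 2)
    (hstep : D.starProjection ((1 + η) • (f' y - f' x) + η • (f' x + L' x)) = 0) :
    σ / (8 * ℓ ^ 2) * (η * ‖D.starProjection (f' x + L' x)‖ ^ 2) ≤ (f x + L x) - (f y + L y) ∧
    ‖D.starProjection (f' y + L' y) - D.starProjection (f' x + L' x)‖
      ≤ (ℓ + Λ) / σ * (η * ‖D.starProjection (f' x + L' x)‖) := by
  set P := D.starProjection with hP
  set d := P (f' y - f' x) with hd
  set G := P (f' x + L' x) with hG
  set n := ‖y - x‖ with hn
  have hn0 : 0 ≤ n := norm_nonneg _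
  have hPle : ∀ z, ‖P z‖ ≤ ‖z‖ := fun z => by
    simpa using P.le_of_opNorm_le D.starProjection_norm_le z
  have hinner : ∀ z, inner ℝ (P z) (y - x) = inner ℝ z (y - x) := fun z => by
    rw [hP, Submodule.inner_starProjection_left_eq_right,
      Submodule.starProjection_eq_self_iff.2 hxy]
  have hdG : (1 + η) • d + η • G = 0 := by
    rw [← hstep, map_add, map_smul, map_smul]
  have hdG' : (1 + η) • d = -(η • G) := eq_neg_of_add_eq_zero_left hdG
  have hnorm : (1 + η) * ‖d‖ = η * ‖G‖ := by
    have := congrArg norm hdG'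
    rwa [norm_neg, norm_smul, norm_smul, Real.norm_of_nonneg hη.le,
      Real.norm_of_nonneg (by linarith : 0 ≤ 1 + η)] at this
  have hdn : ‖d‖ ≤ ℓ * n := (hPle _).trans (hflip y hy x hx)
  have hA : σ * n ^ 2 ≤ inner ℝ d (y - x) := by
    rw [hd, hinner]; exact hmono y hy x hx
  have hdle : ‖d‖ ≤ η * ‖G‖ := by nlinarith [norm_nonneg d]
  have hnG : σ * n ≤ η * ‖G‖ := by
    rcases hn0.eq_or_lt with h0 | hpos
    · rw [← h0, mul_zero]; positivity
    · have h1 : σ * n ^ 2 ≤ ‖d‖ * n := hA.trans (real_inner_le_norm _ _)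
      have h2 : σ * n ≤ ‖d‖ := by
        refine le_of_mul_le_mul_right ?_ hpos
        nlinarith
      exact h2.trans hdle
  constructor
  · have h1 : f y - f x ≤ inner ℝ (f' y) (y - x) :=
      sub_le_inner_of_monotone_gradient hK hf
        (fun a ha b hb => (by positivity : 0 ≤ σ * ‖a - b‖ ^ 2).trans (hmono a ha b hb)) hx hy
    have h2 := sub_le_inner_add_of_lipschitz_gradient hK hΛ hL hLlip hx hy
    have h3 : inner ℝ (f' y) (y - x) + inner ℝ (L' x) (y - x) = inner ℝ (d + G) (y - x) := by
      rw [hd, hG, ← map_add, hinner, ← inner_add_left]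
      congr 1
      module
    -- The optimality condition is `η (d + G) = -d`, which turns the first-order change into strong
    -- monotonicity with a gain `1 / η`; this absorbs the curvature `Λ` of `L`.
    have h4 : η * inner ℝ (d + G) (y - x) = - inner ℝ d (y - x) := by
      rw [← real_inner_smul_left, ← inner_neg_left]
      congr 1
      rw [eq_neg_iff_add_eq_zero, ← hdG]
      module
    have h5 : η * ((f y + L y) - (f x + L x)) ≤ - (σ / 2 * n ^ 2) := by
      have : η * ((f y + L y) - (f x + L x)) ≤ η * (inner ℝ (d + G) (y - x) + Λ * n ^ 2) := by
        gcongr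
        linarith
      nlinarith [mul_le_mul_of_nonneg_right hηΛ (sq_nonneg n)]
    -- Smoothness bounds the step length from below: `η‖G‖ = (1 + η)‖d‖ ≤ 2ℓn`. With the decrease
    -- `σn² / (2η)` this yields the constant `σ / (8ℓ²)`.
    have h6 : (η * ‖G‖) ^ 2 ≤ (2 * (ℓ * n)) ^ 2 := by
      have : η * ‖G‖ ≤ 2 * (ℓ * n) := by nlinarith [norm_nonneg d]
      exact pow_le_pow_left₀ (by positivity) this 2
    have h7 : η * (σ / (8 * ℓ ^ 2) * (η * ‖G‖ ^ 2)) ≤ η * ((f x + L x) - (f y + L y)) := by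
      calc η * (σ / (8 * ℓ ^ 2) * (η * ‖G‖ ^ 2)) = σ / (8 * ℓ ^ 2) * (η * ‖G‖) ^ 2 := by ring
        _ ≤ σ / (8 * ℓ ^ 2) * (2 * (ℓ * n)) ^ 2 := by gcongr
        _ = σ / 2 * n ^ 2 := by field_simp; ring
        _ ≤ _ := by linarith
    exact le_of_mul_le_mul_left h7 hη
  · have h1 : ‖P (f' y + L' y) - G‖ ≤ (ℓ + Λ) * n := by
      rw [hG, ← map_sub]
      refine (hPle _).trans ?_
      have : f' y + L' y - (f' x + L' x) = (f' y - f' x) + (L' y - L' x) := by abel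
      rw [this, add_mul]
      exact (norm_add_le _ _).trans (add_le_add (hflip y hy x hx) (hLlip y hy x hx))
    refine h1.trans ?_
    rw [div_mul_eq_mul_div, le_div_iff₀ hσ]
    calc (ℓ + Λ) * n * σ = (ℓ + Λ) * (σ * n) := by ring
      _ ≤ _ := by gcongr

/-- Convergence of mirror descent, with a strongly convex and smooth mirror map `f`, on the
composite objective `f + L`. -/
theorem tendsto_gradient_of_mirrorDescent (hK : Convex ℝ K) (hKc : IsCompact K)
    (hσ : 0 < σ) (hℓ : 0 < ℓ) (hΛ : 0 ≤ Λ)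
    (hf : ∀ z ∈ K, HasGradientAt f (f' z) z) (hL : ∀ z ∈ K, HasGradientAt L (L' z) z)
    (hmono : ∀ x ∈ K, ∀ y ∈ K, σ * ‖x - y‖ ^ 2 ≤ inner ℝ (f' x - f' y) (x - y))
    (hflip : ∀ x ∈ K, ∀ y ∈ K, ‖f' x - f' y‖ ≤ ℓ * ‖x - y‖)
    (hLlip : ∀ x ∈ K, ∀ y ∈ K, ‖L' x - L' y‖ ≤ Λ * ‖x - y‖)
    {x : ℕ → E} (hx : ∀ t, x t ∈ K) (hxD : ∀ t, x (t + 1) - x t ∈ D) {η : ℕ → ℝ}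
    (hη : ∀ t, 0 < η t) (hη1 : ∀ t, η t ≤ 1) (hηΛ : ∀ t, Λ * η t ≤ σ / 2) (hdiv : ¬ Summable η)
    (hstep : ∀ t, D.starProjection
      ((1 + η t) • (f' (x (t + 1)) - f' (x t)) + η t • (f' (x t) + L' (x t))) = 0) :
    Filter.Tendsto (fun t => ‖D.starProjection (f' (x t) + L' (x t))‖) Filter.atTop (nhds 0) := by
  have key := fun t => mirrorDescent_step hK hσ hℓ hΛ hf hL hmono hflip hLlip (hx t) (hx (t + 1))
    (hxD t) (hη t) (hη1 t) (hηΛ t) (hstep t)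
  set u : ℕ → ℝ := fun t => ‖D.starProjection (f' (x t) + L' (x t))‖ with hu
  have hu0 : ∀ t, 0 ≤ u t := fun t => norm_nonneg _
  have hcont : ContinuousOn (fun z => f z + L z) K := fun z hz =>
    ((hf z hz).continuousAt.add (hL z hz).continuousAt).continuousWithinAt
  obtain ⟨m, hm⟩ := (hKc.bddBelow_image hcont)
  have hm' : ∀ t, m ≤ f (x t) + L (x t) := fun t => hm ⟨x t, hx t, rfl⟩
  set c := σ / (8 * ℓ ^ 2) with hc
  have hc0 : 0 < c := by positivity
  have hsum : Summable fun t => η t * u t ^ 2 := by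
    rw [← summable_mul_left_iff hc0.ne']
    refine summable_of_sum_range_le (c := f (x 0) + L (x 0) - m)
      (fun t => by have := hη t; positivity) fun n => ?_
    calc ∑ t ∈ Finset.range n, c * (η t * u t ^ 2)
        ≤ ∑ t ∈ Finset.range n, ((f (x t) + L (x t)) - (f (x (t + 1)) + L (x (t + 1)))) :=
          Finset.sum_le_sum fun t _ => (key t).1
      _ = (f (x 0) + L (x 0)) - (f (x n) + L (x n)) :=
          Finset.sum_range_sub' (fun t => f (x t) + L (x t)) n
      _ ≤ _ := by linarith [hm' n]
  set C := (ℓ + Λ) / σ with hC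
  have hC0 : 0 ≤ C := by positivity
  -- The summability just obtained concerns `η * u²`, so the Cauchy argument is run on `u²` rather
  -- than on `u`.
  have hinc : ∀ t, |u (t + 1) ^ 2 - u t ^ 2| ≤ C * (2 + C) * (η t * u t ^ 2) := by
    intro t
    have h1 : |u (t + 1) - u t| ≤ C * (η t * u t) := (abs_norm_sub_norm_le _ _).trans (key t).2
    have h3 : C * (η t * u t) ≤ C * u t := by
      have : η t * u t ≤ u t := mul_le_of_le_one_left (hu0 t) (hη1 t)
      gcongr
    have h2 : u (t + 1) + u t ≤ (2 + C) * u t := by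
      linarith [le_abs_self (u (t + 1) - u t)]
    have h4 : u (t + 1) ^ 2 - u t ^ 2 = (u (t + 1) - u t) * (u (t + 1) + u t) := by ring
    have h5 : 0 ≤ u (t + 1) + u t := add_nonneg (hu0 _) (hu0 _)
    rw [h4, abs_mul, abs_of_nonneg h5]
    calc _ ≤ (C * (η t * u t)) * ((2 + C) * u t) := by
          gcongr
          exact (abs_nonneg _).trans h1
      _ = _ := by ring
  have := (tendsto_zero_of_summable_mul (fun t => sq_nonneg (u t)) (fun t => (hη t).le) hsum hinc
    hdiv).sqrt
  simpa [Real.sqrt_sq (hu0 _)] using this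

end MirrorDescent

/-! ### First-order optimality in the relative interior -/

section RelativeInterior

variable {E : Type*} [NormedAddCommGroup E] [InnerProductSpace ℝ E]

lemma eventually_add_smul_mem_of_mem_intrinsicInterior {s : Set E} {x v : E}
    (hx : x ∈ intrinsicInterior ℝ s) (hv : v ∈ (affineSpan ℝ s).direction) :
    ∀ᶠ t : ℝ in nhds 0, x + t • v ∈ s := by
  obtain ⟨p, hp, rfl⟩ := hx
  have hmem : ∀ t : ℝ, (p : E) + t • v ∈ affineSpan ℝ s := fun t => by
    rw [add_comm]
    exact AffineSubspace.vadd_mem_of_mem_direction (Submodule.smul_mem _ t hv) p.2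
  have hcont : Continuous fun t : ℝ => (⟨(p : E) + t • v, hmem t⟩ : affineSpan ℝ s) := by
    fun_prop
  have h0 : (⟨(p : E) + (0 : ℝ) • v, hmem 0⟩ : affineSpan ℝ s) = p := Subtype.ext (by simp)
  have := hcont.continuousAt.eventually_mem (x := 0) (s := interior (Subtype.val ⁻¹' s))
    (by rw [h0]; exact isOpen_interior.mem_nhds hp)
  filter_upwards [this] with t ht
  have := interior_subset ht
  exact this

/-- The first-order optimality condition at a minimizer in the relative interior. -/
lemma starProjection_gradient_eq_zero_of_isMinOn [CompleteSpace E] {s : Set E} {x g : E}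
    [(affineSpan ℝ s).direction.HasOrthogonalProjection]
    {h : E → ℝ} (hx : x ∈ intrinsicInterior ℝ s) (hmin : IsMinOn h s x) (hg : HasGradientAt h g x) :
    (affineSpan ℝ s).direction.starProjection g = 0 := by
  rw [Submodule.starProjection_apply_eq_zero_iff, Submodule.mem_orthogonal']
  intro v hv
  have hloc : IsLocalMin (fun r : ℝ => h (x + r • v)) 0 := by
    filter_upwards [eventually_add_smul_mem_of_mem_intrinsicInterior hx hv] with t ht
    simpa using hmin ht
  exact hloc.hasDerivAt_eq_zero (HasGradientAt.hasDerivAt_lineMap (by simpa using hg))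

end RelativeInterior

/-! ### Derivatives of the Bethe entropy and local consistency -/

variable {V : Type*} [Fintype V] [DecidableEq V]
variable {X : V → Type*} [∀ i, Fintype (X i)] [∀ i, DecidableEq (X i)]

/-- The counting numbers of the Bethe entropy, indexed by coordinates. -/
def countingNumber (𝒞 : Finset (Finset V)) : Idx X 𝒞 → ℝ :=
  Sum.elim (fun p => -((cliqueDegree 𝒞 p.1 : ℝ) - 1)) (fun _ => 1)

lemma sum_countingNumber_mul (𝒞 : Finset (Finset V)) (h : Idx X 𝒞 → ℝ) :
    ∑ k, countingNumber 𝒞 k * h k =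
      (∑ c : {c : Finset V // c ∈ 𝒞}, ∑ x : ((i : {i : V // i ∈ c.1}) → X i.1),
        h (Sum.inr ⟨c, x⟩))
      - ∑ i : V, ((cliqueDegree 𝒞 i : ℝ) - 1) * ∑ x : X i, h (Sum.inl ⟨i, x⟩) := by
  rw [Fintype.sum_sum_type, Fintype.sum_sigma, Fintype.sum_sigma, add_comm, sub_eq_add_neg,
    ← Finset.sum_neg_distrib]
  congr 1
  · simp [countingNumber]
  · refine Finset.sum_congr rfl fun i _ => ?_
    rw [Finset.mul_sum, ← Finset.sum_neg_distrib]
    exact Finset.sum_congr rfl fun x _ => neg_mul _ _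

lemma betheEntropy_eq_sum (𝒞 : Finset (Finset V)) (μ : Vec X 𝒞) :
    betheEntropy 𝒞 μ = ∑ k, countingNumber 𝒞 k * Real.negMulLog (μ k) :=
  (sum_countingNumber_mul 𝒞 fun k => Real.negMulLog (μ k)).symm

/-- The gradient of the Bethe entropy at a positive vector. -/
def betheGradient (𝒞 : Finset (Finset V)) (μ : Vec X 𝒞) : Vec X 𝒞 :=
  WithLp.toLp 2 fun k => countingNumber 𝒞 k * (-Real.log (μ k) - 1)

lemma hasGradientAt_betheEntropy (𝒞 : Finset (Finset V)) {μ : Vec X 𝒞} (hμ : ∀ k, μ k ≠ 0) :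
    HasGradientAt (betheEntropy 𝒞) (betheGradient 𝒞 μ) μ := by
  rw [hasGradientAt_iff_hasFDerivAt, funext (betheEntropy_eq_sum (X := X) 𝒞)]
  have h : ∀ k : Idx X 𝒞, HasFDerivAt (fun ν : Vec X 𝒞 =>
      countingNumber 𝒞 k * Real.negMulLog (ν k))
      (countingNumber 𝒞 k • ((-Real.log (μ k) - 1) •
        (EuclideanSpace.proj k : Vec X 𝒞 →L[ℝ] ℝ))) μ := fun k => by
    have h1 := (Real.hasDerivAt_negMulLog (hμ k)).comp_hasFDerivAt μ
      (EuclideanSpace.proj k : Vec X 𝒞 →L[ℝ] ℝ).hasFDerivAt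
    exact h1.const_mul _
  refine (HasFDerivAt.fun_sum fun k _ => h k).congr_fderiv ?_
  ext v
  simp [betheGradient, PiLp.inner_apply, mul_comm, mul_assoc]

/-- The quadratic form of the Hessian of the negative Bethe entropy. -/
def betheQuad (𝒞 : Finset (Finset V)) (μ v : Vec X 𝒞) : ℝ :=
  ∑ k, countingNumber 𝒞 k * (v k ^ 2 / μ k)

/-- The vector has total mass `m` at every node, and its clique blocks marginalize to its node
blocks. -/
structure IsConsistent (𝒞 : Finset (Finset V)) (m : ℝ) (w : Vec X 𝒞) : Prop where
  mass : ∀ i, ∑ a, w (Sum.inl ⟨i, a⟩) = m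
  marg : ∀ (c : {c : Finset V // c ∈ 𝒞}) (i : {i : V // i ∈ c.1}) (a : X i.1),
    (∑ x : ((i : {i : V // i ∈ c.1}) → X i.1), if x i = a then w (Sum.inr ⟨c, x⟩) else 0) =
      w (Sum.inl ⟨i.1, a⟩)

variable {𝒞 : Finset (Finset V)}

lemma IsConsistent.combo {m n a b : ℝ} {v w : Vec X 𝒞} (hv : IsConsistent 𝒞 m v)
    (hw : IsConsistent 𝒞 n w) : IsConsistent 𝒞 (a * m + b * n) (a • v + b • w) where
  mass i := by
    simp only [PiLp.add_apply, PiLp.smul_apply, smul_eq_mul, Finset.sum_add_distrib,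
      ← Finset.mul_sum, hv.mass, hw.mass]
  marg c i s := by
    simp only [PiLp.add_apply, PiLp.smul_apply, smul_eq_mul, ← hv.marg c i s, ← hw.marg c i s,
      Finset.mul_sum, ← Finset.sum_add_distrib]
    refine Finset.sum_congr rfl fun x _ => ?_
    split_ifs <;> simp

lemma IsConsistent.sub {m n : ℝ} {v w : Vec X 𝒞} (hv : IsConsistent 𝒞 m v)
    (hw : IsConsistent 𝒞 n w) : IsConsistent 𝒞 (m - n) (v - w) := by
  simpa [sub_eq_add_neg] using hv.combo (a := 1) (b := -1) hw

lemma suffStat_inl (y : (i : V) → X i) (i : V) (a : X i) :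
    suffStat 𝒞 y (Sum.inl ⟨i, a⟩) = if y i = a then 1 else 0 := rfl

lemma suffStat_inr (y : (i : V) → X i) (c : {c : Finset V // c ∈ 𝒞})
    (x : (i : {i : V // i ∈ c.1}) → X i.1) :
    suffStat 𝒞 y (Sum.inr ⟨c, x⟩) = if (fun i : {i : V // i ∈ c.1} => y i.1) = x then 1 else 0 := by
  change (if _ then _ else _) = _
  simp only [funext_iff]

lemma isConsistent_suffStat (y : (i : V) → X i) : IsConsistent 𝒞 1 (suffStat 𝒞 y) where
  mass i := by simp [suffStat_inl]
  marg c i a := by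
    simp only [suffStat_inr, suffStat_inl]
    rw [Finset.sum_eq_single (fun i : {i : V // i ∈ c.1} => y i.1)]
    · simp
    · intro b _ hb
      simp [Ne.symm hb]
    · simp

lemma isConsistent_of_mem {μ : Vec X 𝒞} (hμ : μ ∈ marginalPolytope X 𝒞) : IsConsistent 𝒞 1 μ := by
  have hconv : Convex ℝ {w : Vec X 𝒞 | IsConsistent 𝒞 1 w} := by
    intro v hv w hw a b _ _ hab
    simpa [hab] using IsConsistent.combo (a := a) (b := b) hv hw
  refine convexHull_min ?_ hconv hμ
  rintro _ ⟨y, rfl⟩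
  exact isConsistent_suffStat y

lemma nonneg_of_mem {μ : Vec X 𝒞} (hμ : μ ∈ marginalPolytope X 𝒞) (k : Idx X 𝒞) : 0 ≤ μ k := by
  have hconv : Convex ℝ {w : Vec X 𝒞 | 0 ≤ w k} := by
    intro v hv w hw a b ha hb _
    simp only [Set.mem_ofPred_eq, PiLp.add_apply, PiLp.smul_apply, smul_eq_mul] at *
    positivity
  refine convexHull_min ?_ hconv hμ
  rintro _ ⟨y, rfl⟩
  rcases k with ⟨i, a⟩ | ⟨c, x⟩
  · simp only [Set.mem_ofPred_eq, suffStat_inl]; split_ifs <;> norm_num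
  · simp only [Set.mem_ofPred_eq, suffStat_inr]; split_ifs <;> norm_num

/-- Expectations of functions of one node can be taken under the clique marginal; this handles the
cross terms in `cliqueQuad_sub_nodeQuad`. -/
lemma IsConsistent.sum_mul {m : ℝ} {w : Vec X 𝒞} (hw : IsConsistent 𝒞 m w)
    (c : {c : Finset V // c ∈ 𝒞}) (i : {i : V // i ∈ c.1}) (g : X i.1 → ℝ) :
    ∑ x : ((i : {i : V // i ∈ c.1}) → X i.1), g (x i) * w (Sum.inr ⟨c, x⟩) =
      ∑ a, g a * w (Sum.inl ⟨i.1, a⟩) := by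
  simp only [← hw.marg c i, Finset.mul_sum, mul_ite, mul_zero]
  rw [Finset.sum_comm]
  simp

/-- The node part of the quadratic form. -/
def nodeQuad (μ v : Vec X 𝒞) (i : V) : ℝ :=
  ∑ a : X i, v (Sum.inl ⟨i, a⟩) ^ 2 / μ (Sum.inl ⟨i, a⟩)

/-- The clique part of the quadratic form. -/
def cliqueQuad (μ v : Vec X 𝒞) (c : {c : Finset V // c ∈ 𝒞}) : ℝ :=
  ∑ x : ((i : {i : V // i ∈ c.1}) → X i.1), v (Sum.inr ⟨c, x⟩) ^ 2 / μ (Sum.inr ⟨c, x⟩)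

lemma betheQuad_eq (μ v : Vec X 𝒞) : betheQuad 𝒞 μ v =
    ∑ c, cliqueQuad μ v c - ∑ i, ((cliqueDegree 𝒞 i : ℝ) - 1) * nodeQuad μ v i :=
  sum_countingNumber_mul 𝒞 fun k => v k ^ 2 / μ k

/-! ### Definiteness of the Hessian form, given a matching -/

section Definite

variable {μ v : Vec X 𝒞}

lemma nodeQuad_nonneg (hpos : ∀ k, 0 < μ k) (i : V) : 0 ≤ nodeQuad μ v i :=
  Finset.sum_nonneg fun _ _ => div_nonneg (sq_nonneg _) (hpos _).le

lemma cliqueQuad_nonneg (hpos : ∀ k, 0 < μ k) (c : {c : Finset V // c ∈ 𝒞}) :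
    0 ≤ cliqueQuad μ v c :=
  Finset.sum_nonneg fun _ _ => div_nonneg (sq_nonneg _) (hpos _).le

lemma eq_zero_of_nodeQuad_eq_zero (hpos : ∀ k, 0 < μ k) {i : V} (h : nodeQuad μ v i = 0)
    (a : X i) : v (Sum.inl ⟨i, a⟩) = 0 := by
  rw [nodeQuad, Finset.sum_eq_zero_iff_of_nonneg
    (by intro a _; exact div_nonneg (sq_nonneg _) (hpos _).le)] at h
  have := h a (Finset.mem_univ _)
  simpa [(hpos _).ne'] using this

lemma eq_zero_of_cliqueQuad_eq_zero (hpos : ∀ k, 0 < μ k) {c : {c : Finset V // c ∈ 𝒞}}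
    (h : cliqueQuad μ v c = 0) (x : (i : {i : V // i ∈ c.1}) → X i.1) :
    v (Sum.inr ⟨c, x⟩) = 0 := by
  rw [cliqueQuad, Finset.sum_eq_zero_iff_of_nonneg
    (by intro a _; exact div_nonneg (sq_nonneg _) (hpos _).le)] at h
  have := h x (Finset.mem_univ _)
  simpa [(hpos _).ne'] using this

lemma nodeQuad_eq_zero_of_subsingleton {i : V} [Subsingleton (X i)] (hv : IsConsistent 𝒞 0 v) :
    nodeQuad μ v i = 0 := by
  refine Finset.sum_eq_zero fun a _ => ?_
  have h := hv.mass i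
  rw [Fintype.sum_subsingleton _ a] at h
  simp [h]

/-- A variance decomposition: under `μ_c`, the node ratio `v_i / μ_i` is the conditional expectation
of the clique ratio `v_c / μ_c` given `x_i`, so the difference of second moments is the mean squared
deviation. -/
lemma cliqueQuad_sub_nodeQuad (hpos : ∀ k, 0 < μ k) {m n : ℝ} (hμ : IsConsistent 𝒞 m μ)
    (hv : IsConsistent 𝒞 n v) (c : {c : Finset V // c ∈ 𝒞}) (i : {i : V // i ∈ c.1}) :
    cliqueQuad μ v c - nodeQuad μ v i.1 =
      ∑ x : ((i : {i : V // i ∈ c.1}) → X i.1), μ (Sum.inr ⟨c, x⟩) *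
        (v (Sum.inr ⟨c, x⟩) / μ (Sum.inr ⟨c, x⟩) -
          v (Sum.inl ⟨i.1, x i⟩) / μ (Sum.inl ⟨i.1, x i⟩)) ^ 2 := by
  have h1 := hμ.sum_mul c i fun a => (v (Sum.inl ⟨i.1, a⟩) / μ (Sum.inl ⟨i.1, a⟩)) ^ 2
  have h2 := hv.sum_mul c i fun a => v (Sum.inl ⟨i.1, a⟩) / μ (Sum.inl ⟨i.1, a⟩)
  have h3 : ∑ a, (v (Sum.inl ⟨i.1, a⟩) / μ (Sum.inl ⟨i.1, a⟩)) ^ 2 * μ (Sum.inl ⟨i.1, a⟩) =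
      nodeQuad μ v i.1 := Finset.sum_congr rfl fun a _ => by
    have := (hpos (Sum.inl ⟨i.1, a⟩)).ne'
    field_simp
  have h4 : ∑ a, v (Sum.inl ⟨i.1, a⟩) / μ (Sum.inl ⟨i.1, a⟩) * v (Sum.inl ⟨i.1, a⟩) =
      nodeQuad μ v i.1 := Finset.sum_congr rfl fun a _ => by ring
  rw [h3] at h1
  rw [h4] at h2
  have h5 : ∀ x : ((i : {i : V // i ∈ c.1}) → X i.1), μ (Sum.inr ⟨c, x⟩) *
        (v (Sum.inr ⟨c, x⟩) / μ (Sum.inr ⟨c, x⟩) -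
          v (Sum.inl ⟨i.1, x i⟩) / μ (Sum.inl ⟨i.1, x i⟩)) ^ 2 =
      v (Sum.inr ⟨c, x⟩) ^ 2 / μ (Sum.inr ⟨c, x⟩)
      - 2 * (v (Sum.inl ⟨i.1, x i⟩) / μ (Sum.inl ⟨i.1, x i⟩) * v (Sum.inr ⟨c, x⟩))
      + (v (Sum.inl ⟨i.1, x i⟩) / μ (Sum.inl ⟨i.1, x i⟩)) ^ 2 * μ (Sum.inr ⟨c, x⟩) := fun x => by
    have := (hpos (Sum.inr ⟨c, x⟩)).ne'
    have := (hpos (Sum.inl ⟨i.1, x i⟩)).ne'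
    field_simp
    ring
  rw [Finset.sum_congr rfl fun x _ => h5 x, Finset.sum_add_distrib, Finset.sum_sub_distrib,
    ← Finset.mul_sum, h1, h2, cliqueQuad]
  ring

lemma nodeQuad_le_cliqueQuad (hpos : ∀ k, 0 < μ k) {m n : ℝ} (hμ : IsConsistent 𝒞 m μ)
    (hv : IsConsistent 𝒞 n v) (c : {c : Finset V // c ∈ 𝒞}) {i : V} (hi : i ∈ c.1) :
    nodeQuad μ v i ≤ cliqueQuad μ v c := by
  rw [← sub_nonneg, cliqueQuad_sub_nodeQuad hpos hμ hv c ⟨i, hi⟩]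
  exact Finset.sum_nonneg fun x _ => mul_nonneg (hpos _).le (sq_nonneg _)

lemma div_eq_div_of_cliqueQuad_eq (hpos : ∀ k, 0 < μ k) {m n : ℝ} (hμ : IsConsistent 𝒞 m μ)
    (hv : IsConsistent 𝒞 n v) {c : {c : Finset V // c ∈ 𝒞}} {i : V} (hi : i ∈ c.1)
    (h : cliqueQuad μ v c = nodeQuad μ v i) (x : (i : {i : V // i ∈ c.1}) → X i.1) :
    v (Sum.inr ⟨c, x⟩) / μ (Sum.inr ⟨c, x⟩) =
      v (Sum.inl ⟨i, x ⟨i, hi⟩⟩) / μ (Sum.inl ⟨i, x ⟨i, hi⟩⟩) := by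
  have h0 := cliqueQuad_sub_nodeQuad hpos hμ hv c ⟨i, hi⟩
  rw [h, sub_self, eq_comm, Finset.sum_eq_zero_iff_of_nonneg
    (by intro x _; exact mul_nonneg (hpos _).le (sq_nonneg _))] at h0
  have := h0 x (Finset.mem_univ _)
  have h1 := pow_eq_zero_iff (two_ne_zero) |>.1
    ((mul_eq_zero.1 this).resolve_left (hpos (Sum.inr ⟨c, x⟩)).ne')
  exact sub_eq_zero.1 h1

/-- If two nodes of a clique both carry the whole quadratic form of the clique, it vanishes. -/
lemma nodeQuad_eq_zero_of_two (hne : ∀ i, Nonempty (X i)) (hpos : ∀ k, 0 < μ k)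
    (hμ : IsConsistent 𝒞 1 μ)
    (hv : IsConsistent 𝒞 0 v) {c : {c : Finset V // c ∈ 𝒞}} {i j : V} (hi : i ∈ c.1) (hj : j ∈ c.1)
    (hij : i ≠ j) (h1 : cliqueQuad μ v c = nodeQuad μ v i) (h2 : cliqueQuad μ v c = nodeQuad μ v j) :
    nodeQuad μ v i = 0 := by
  -- Both node ratios equal the clique ratio. As `i ≠ j`, the states `a` and `b` can be prescribed
  -- together, so the ratio is a constant `r`; the masses 0 of `v` and 1 of `μ` then force `r = 0`.
  have h3 : ∀ (a : X i) (b : X j), v (Sum.inl ⟨i, a⟩) / μ (Sum.inl ⟨i, a⟩) =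
      v (Sum.inl ⟨j, b⟩) / μ (Sum.inl ⟨j, b⟩) := fun a b => by
    let y : (k : V) → X k :=
      Function.update (Function.update (fun k => (hne k).some) i a) j b
    have hyi : y i = a := by simp [y, Function.update_of_ne hij]
    have hyj : y j = b := by simp [y]
    have e1 := div_eq_div_of_cliqueQuad_eq hpos hμ hv hi h1 fun k => y k.1
    have e2 := div_eq_div_of_cliqueQuad_eq hpos hμ hv hj h2 fun k => y k.1
    simp only [hyi] at e1
    simp only [hyj] at e2
    exact e1.symm.trans e2
  obtain ⟨b⟩ := hne j
  set r := v (Sum.inl ⟨j, b⟩) / μ (Sum.inl ⟨j, b⟩) with hr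
  have h4 : ∀ a : X i, v (Sum.inl ⟨i, a⟩) = r * μ (Sum.inl ⟨i, a⟩) := fun a => by
    rw [hr, ← h3 a b, div_mul_cancel₀ _ (hpos _).ne']
  have h5 : r = 0 := by
    have := hv.mass i
    simpa only [h4, ← Finset.mul_sum, hμ.mass, mul_one] using this
  exact Finset.sum_eq_zero fun a _ => by simp [h4, h5]

open Classical in
/-- The number of cliques that have to compensate for the entropy of a node. -/
def nodeDemand (X : V → Type*) (𝒞 : Finset (Finset V)) (i : V) : ℕ :=
  if Nontrivial (X i) then cliqueDegree 𝒞 i - 1 else 0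

lemma nodeDemand_le (X : V → Type*) (𝒞 : Finset (Finset V)) (i : V) :
    nodeDemand X 𝒞 i ≤ cliqueDegree 𝒞 i - 1 := by
  unfold nodeDemand; split_ifs <;> simp

/-- If the demands of the nodes can be matched to cliques, the quadratic form is definite on the
directions of the marginal polytope. -/
lemma eq_zero_of_betheQuad_nonpos (hne : ∀ i, Nonempty (X i))
    {φ : (Σ i, Fin (nodeDemand X 𝒞 i)) → {c : Finset V // c ∈ 𝒞}} (hφ : Function.Injective φ)
    (hmem : ∀ p, p.1 ∈ (φ p).1) (hpos : ∀ k, 0 < μ k) (hμ : IsConsistent 𝒞 1 μ)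
    (hv : IsConsistent 𝒞 0 v) (hQ : betheQuad 𝒞 μ v ≤ 0) : v = 0 := by
  -- Natural subtraction gives demand 0 to a node in no clique, where the real coefficient is -1;
  -- the last term corrects this. At a one-state node the form vanishes, so demand 0 is harmless.
  have hdem : ∀ i, ((cliqueDegree 𝒞 i : ℝ) - 1) * nodeQuad μ v i =
      (nodeDemand X 𝒞 i : ℝ) * nodeQuad μ v i -
        if cliqueDegree 𝒞 i = 0 then nodeQuad μ v i else 0 := fun i => by
    by_cases hX : Nontrivial (X i)
    · rw [nodeDemand, if_pos hX]
      split_ifs with h0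
      · simp [h0]
      · rw [Nat.cast_sub (Nat.one_le_iff_ne_zero.2 h0)]; simp
    · have := not_nontrivial_iff_subsingleton.1 hX
      simp [nodeQuad_eq_zero_of_subsingleton hv]
  have hsum : ∑ p : (Σ i, Fin (nodeDemand X 𝒞 i)), nodeQuad μ v p.1 =
      ∑ i, (nodeDemand X 𝒞 i : ℝ) * nodeQuad μ v i := by
    rw [Fintype.sum_sigma]; simp
  -- The form splits into unmatched cliques, matched cliques minus their nodes, and nodes without
  -- cliques. All terms are nonnegative, so `hQ` forces each to vanish.
  have himg := Finset.sum_add_sum_compl (Finset.univ.image φ) (cliqueQuad μ v)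
  rw [Finset.sum_image fun a _ b _ h => hφ h] at himg
  have hA0 : ∀ c ∈ (Finset.univ.image φ)ᶜ, 0 ≤ cliqueQuad μ v c :=
    fun c _ => cliqueQuad_nonneg hpos c
  have hB0 : ∀ p ∈ (Finset.univ : Finset (Σ i, Fin (nodeDemand X 𝒞 i))),
      0 ≤ cliqueQuad μ v (φ p) - nodeQuad μ v p.1 :=
    fun p _ => sub_nonneg.2 (nodeQuad_le_cliqueQuad hpos hμ hv _ (hmem p))
  have hC0 : ∀ i ∈ (Finset.univ : Finset V),
      0 ≤ if cliqueDegree 𝒞 i = 0 then nodeQuad μ v i else 0 := fun i _ => by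
    split_ifs
    exacts [nodeQuad_nonneg hpos i, le_rfl]
  have hA := Finset.sum_nonneg hA0
  have hB := Finset.sum_nonneg hB0
  have hC := Finset.sum_nonneg hC0
  rw [betheQuad_eq, Finset.sum_congr rfl fun i _ => hdem i, Finset.sum_sub_distrib, ← hsum,
    ← himg] at hQ
  rw [Finset.sum_sub_distrib] at hB
  have hA' : ∀ c, c ∉ Finset.univ.image φ → cliqueQuad μ v c = 0 := fun c hc =>
    (Finset.sum_eq_zero_iff_of_nonneg hA0).1 (by linarith) c (Finset.mem_compl.2 hc)
  have hB' : ∀ p, cliqueQuad μ v (φ p) = nodeQuad μ v p.1 := fun p =>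
    sub_eq_zero.1 ((Finset.sum_eq_zero_iff_of_nonneg hB0).1
      (by rw [Finset.sum_sub_distrib]; linarith) p (Finset.mem_univ _))
  have hC' : ∀ i, cliqueDegree 𝒞 i = 0 → nodeQuad μ v i = 0 := fun i h0 => by
    simpa [h0] using (Finset.sum_eq_zero_iff_of_nonneg hC0).1 (by linarith) i (Finset.mem_univ _)
  have hnode : ∀ i, nodeQuad μ v i = 0 := by
    intro i'
    -- A node `i` with maximal form suffices. Its demand is below its degree, so some clique `c` at
    -- `i` is not assigned to `i`. If `c` is unmatched, its form is zero and dominates that of `i`;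
    -- if it is assigned to `j ≠ i`, maximality makes both nodes carry the whole form of `c`.
    obtain ⟨i, -, hi⟩ := Finset.exists_max_image Finset.univ (nodeQuad μ v)
      ⟨i', Finset.mem_univ _⟩
    suffices h : nodeQuad μ v i = 0 from
      le_antisymm (h ▸ hi i' (Finset.mem_univ _)) (nodeQuad_nonneg hpos _)
    by_cases h0 : cliqueDegree 𝒞 i = 0
    · exact hC' i h0
    obtain ⟨c, hc, hcφ⟩ : ∃ c ∈ 𝒞.filter (i ∈ ·),
        c ∉ Finset.univ.image fun k : Fin (nodeDemand X 𝒞 i) => (φ ⟨i, k⟩).1 := by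
      by_contra! hcon
      have h1 := Finset.card_le_card (s := 𝒞.filter (i ∈ ·))
        (t := Finset.univ.image fun k : Fin (nodeDemand X 𝒞 i) => (φ ⟨i, k⟩).1) hcon
      have h2 := h1.trans Finset.card_image_le
      rw [Finset.card_univ, Fintype.card_fin] at h2
      have h3 := nodeDemand_le X 𝒞 i
      change cliqueDegree 𝒞 i ≤ _ at h2
      omega
    obtain ⟨hc𝒞, hic⟩ := Finset.mem_filter.1 hc
    by_cases hr : (⟨c, hc𝒞⟩ : {c : Finset V // c ∈ 𝒞}) ∈ Finset.univ.image φ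
    · obtain ⟨⟨j, k⟩, -, hjk⟩ := Finset.mem_image.1 hr
      have hj := hmem ⟨j, k⟩
      have hq := hB' ⟨j, k⟩
      rw [hjk] at hj hq
      have hij : i ≠ j := by
        rintro rfl
        exact hcφ (Finset.mem_image.2 ⟨k, Finset.mem_univ _, by rw [hjk]⟩)
      have hle := nodeQuad_le_cliqueQuad hpos hμ hv ⟨c, hc𝒞⟩ hic
      have hge := hi j (Finset.mem_univ _)
      exact nodeQuad_eq_zero_of_two hne hpos hμ hv (c := ⟨c, hc𝒞⟩) hic hj hij
        (le_antisymm (hq.le.trans hge) hle) hq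
    · exact le_antisymm ((nodeQuad_le_cliqueQuad hpos hμ hv ⟨c, hc𝒞⟩ hic).trans (hA' _ hr).le)
        (nodeQuad_nonneg hpos _)
  ext k
  rcases k with ⟨i, a⟩ | ⟨c, x⟩
  · exact eq_zero_of_nodeQuad_eq_zero hpos (hnode i) a
  · refine eq_zero_of_cliqueQuad_eq_zero hpos ?_ x
    by_cases hr : c ∈ Finset.univ.image φ
    · obtain ⟨p, -, rfl⟩ := Finset.mem_image.1 hr
      rw [hB', hnode]
    · exact hA' c hr

end Definite

/-! ### From convexity to a matching, by Hall's theorem -/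

section Matching

/-- The mixture of two point masses is either a point mass or a fair coin, so midpoints of vertices
turn the Bethe entropy into a count. -/
lemma sum_negMulLog_indicator {T : Type*} [Fintype T] [DecidableEq T] (a b : T) :
    ∑ t, Real.negMulLog ((1 / 2 : ℝ) * (if a = t then 1 else 0) + 1 / 2 * if b = t then 1 else 0) =
      if a = b then 0 else Real.log 2 := by
  split_ifs with h
  · subst h
    refine Finset.sum_eq_zero fun t _ => ?_
    split_ifs <;> norm_num
  · have h0 : ∀ t, t ∉ ({a, b} : Finset T) → Real.negMulLog ((1 / 2 : ℝ) *
        (if a = t then 1 else 0) + 1 / 2 * if b = t then 1 else 0) = 0 := fun t ht => by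
      simp only [Finset.mem_insert, Finset.mem_singleton, not_or] at ht
      simp [Ne.symm ht.1, Ne.symm ht.2]
    rw [← Finset.sum_subset (Finset.subset_univ {a, b}) fun t _ => h0 t, Finset.sum_pair h]
    simp [h, Ne.symm h, Real.negMulLog, Real.log_inv]
    ring

/-- The Bethe entropy of the midpoint of two vertices of the marginal polytope. -/
lemma betheEntropy_midpoint_suffStat (y z : (i : V) → X i) :
    betheEntropy 𝒞 ((1 / 2 : ℝ) • suffStat 𝒞 y + (1 / 2 : ℝ) • suffStat 𝒞 z) =
      (∑ c : {c : Finset V // c ∈ 𝒞}, if (∃ i ∈ c.1, y i ≠ z i) then Real.log 2 else 0)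
      - ∑ i, ((cliqueDegree 𝒞 i : ℝ) - 1) * if y i = z i then 0 else Real.log 2 := by
  simp only [betheEntropy, PiLp.add_apply, PiLp.smul_apply, smul_eq_mul, suffStat_inl,
    suffStat_inr, sum_negMulLog_indicator]
  congr 1
  refine Finset.sum_congr rfl fun c _ => ?_
  by_cases h : ∃ i ∈ c.1, y i ≠ z i
  · rw [if_pos h, if_neg]
    obtain ⟨i, hi, hne⟩ := h
    exact fun he => hne (congrFun he ⟨i, hi⟩)
  · rw [if_neg h, if_pos]
    push Not at h
    exact funext fun i => h i.1 i.2

lemma betheEntropy_suffStat (y : (i : V) → X i) : betheEntropy 𝒞 (suffStat 𝒞 y) = 0 := by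
  have h := betheEntropy_midpoint_suffStat (𝒞 := 𝒞) y y
  rw [← add_smul] at h
  norm_num at h
  exact h

lemma suffStat_mem (y : (i : V) → X i) : suffStat 𝒞 y ∈ marginalPolytope X 𝒞 :=
  subset_convexHull _ _ ⟨y, rfl⟩

/-- Convexity of the negative Bethe entropy bounds the excess degree of every set of nontrivial
nodes by the number of cliques that meet it. -/
lemma sum_degree_sub_one_le (hne : ∀ i, Nonempty (X i))
    (hconv : ConvexOn ℝ (marginalPolytope X 𝒞) fun μ => -betheEntropy 𝒞 μ) (A : Finset V)
    (hA : ∀ i ∈ A, Nontrivial (X i)) :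
    ∑ i ∈ A, ((cliqueDegree 𝒞 i : ℝ) - 1) ≤
      (Finset.univ.filter fun c : {c : Finset V // c ∈ 𝒞} => ∃ i ∈ c.1, i ∈ A).card := by
  obtain ⟨y⟩ : Nonempty ((i : V) → X i) := inferInstance
  -- The test segment joins two configurations that differ exactly on `A`. The Bethe entropy
  -- vanishes at both ends, so convexity makes it nonnegative at the midpoint.
  have hz : ∀ i, ∃ b : X i, y i ≠ b ↔ i ∈ A := fun i => by
    by_cases hi : i ∈ A
    · have := hA i hi
      obtain ⟨b, hb⟩ := exists_ne (y i)
      exact ⟨b, by simp [hi, hb.symm]⟩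
    · exact ⟨y i, by simp [hi]⟩
  choose z hz using hz
  have h := hconv.2 (suffStat_mem (𝒞 := 𝒞) y) (suffStat_mem z) (by norm_num : (0 : ℝ) ≤ 1 / 2)
    (by norm_num : (0 : ℝ) ≤ 1 / 2) (by norm_num)
  have hz' : ∀ i, (y i = z i) ↔ i ∉ A := fun i => by rw [← hz i, not_not]
  simp only [betheEntropy_suffStat, betheEntropy_midpoint_suffStat, hz, hz'] at h
  have hlog : 0 < Real.log 2 := Real.log_pos one_lt_two
  have e1 : (∑ c : {c : Finset V // c ∈ 𝒞}, if (∃ i ∈ c.1, i ∈ A) then Real.log 2 else 0) =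
      (Finset.univ.filter fun c : {c : Finset V // c ∈ 𝒞} => ∃ i ∈ c.1, i ∈ A).card *
        Real.log 2 := by
    rw [← Finset.sum_filter]; simp
  have e2 : (∑ i, ((cliqueDegree 𝒞 i : ℝ) - 1) * if i ∉ A then 0 else Real.log 2) =
      (∑ i ∈ A, ((cliqueDegree 𝒞 i : ℝ) - 1)) * Real.log 2 := by
    rw [Finset.sum_mul, ← Finset.sum_subset (Finset.subset_univ A) fun i _ hi => by simp [hi]]
    exact Finset.sum_congr rfl fun i hi => by simp [hi]
  rw [e1, e2] at h
  refine le_of_mul_le_mul_right ?_ hlog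
  simp only [neg_zero, smul_zero, add_zero] at h
  linarith

/-- Hall's condition for the demands of the nodes. -/
lemma card_le_card_biUnion_cliques (hne : ∀ i, Nonempty (X i))
    (hconv : ConvexOn ℝ (marginalPolytope X 𝒞) fun μ => -betheEntropy 𝒞 μ)
    (s : Finset (Σ i, Fin (nodeDemand X 𝒞 i))) :
    s.card ≤ (s.biUnion fun p =>
      Finset.univ.filter fun c : {c : Finset V // c ∈ 𝒞} => p.1 ∈ c.1).card := by
  set A : Finset V := s.image Sigma.fst with hA
  -- Nodes occurring in `s` have positive demand, so neither the truncated subtraction nor the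
  -- one-state case intervenes.
  have hdem : ∀ i ∈ A, Nontrivial (X i) ∧ (nodeDemand X 𝒞 i : ℝ) = (cliqueDegree 𝒞 i : ℝ) - 1 := by
    intro i hi
    obtain ⟨⟨j, k⟩, -, rfl⟩ := Finset.mem_image.1 hi
    have hk : 0 < nodeDemand X 𝒞 j := k.pos
    dsimp only
    unfold nodeDemand at hk ⊢
    split_ifs at hk ⊢ with h
    · refine ⟨h, ?_⟩
      rw [Nat.cast_sub (by omega)]
      simp
    · omega
  have h1 : s.card ≤ ∑ i ∈ A, nodeDemand X 𝒞 i := by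
    have hsub : s ⊆ A.sigma fun _ => Finset.univ := fun p hp =>
      Finset.mem_sigma.2 ⟨Finset.mem_image_of_mem _ hp, Finset.mem_univ _⟩
    simpa using Finset.card_le_card hsub
  have h2 := sum_degree_sub_one_le hne hconv A fun i hi => (hdem i hi).1
  rw [← Finset.sum_congr rfl fun i hi => (hdem i hi).2, ← Nat.cast_sum, Nat.cast_le] at h2
  refine h1.trans (h2.trans (Finset.card_le_card fun c hc => ?_))
  obtain ⟨i, hic, hiA⟩ := (Finset.mem_filter.1 hc).2
  obtain ⟨p, hp, rfl⟩ := Finset.mem_image.1 hiA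
  exact Finset.mem_biUnion.2 ⟨p, hp, Finset.mem_filter.2 ⟨Finset.mem_univ _, hic⟩⟩

/-- Convexity of the negative Bethe entropy allows to match the demands of the nodes with
cliques. -/
lemma exists_matching (hne : ∀ i, Nonempty (X i))
    (hconv : ConvexOn ℝ (marginalPolytope X 𝒞) fun μ => -betheEntropy 𝒞 μ) :
    ∃ φ : (Σ i, Fin (nodeDemand X 𝒞 i)) → {c : Finset V // c ∈ 𝒞}, Function.Injective φ ∧
      ∀ p, p.1 ∈ (φ p).1 := by
  obtain ⟨φ, hφ, hmem⟩ := (Finset.all_card_le_biUnion_card_iff_exists_injective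
    fun p : (Σ i, Fin (nodeDemand X 𝒞 i)) =>
      Finset.univ.filter fun c : {c : Finset V // c ∈ 𝒞} => p.1 ∈ c.1).1
    fun s => card_le_card_biUnion_cliques hne hconv s
  exact ⟨φ, hφ, fun p => (Finset.mem_filter.1 (hmem p)).2⟩

end Matching

/-! ### Distance from the relative boundary bounds all entries below -/

section Core

lemma isCompact_marginalPolytope (𝒞 : Finset (Finset V)) : IsCompact (marginalPolytope X 𝒞) :=
  (Set.finite_range _).isCompact_convexHull ℝ

lemma convex_marginalPolytope (𝒞 : Finset (Finset V)) : Convex ℝ (marginalPolytope X 𝒞) :=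
  convex_convexHull ℝ _

/-- The marginal vectors all of whose entries are at least `ε`. -/
def core (X : V → Type*) [∀ i, Fintype (X i)] [∀ i, DecidableEq (X i)] (𝒞 : Finset (Finset V))
    (ε : ℝ) : Set (Vec X 𝒞) :=
  marginalPolytope X 𝒞 ∩ {μ | ∀ k, ε ≤ μ k}

lemma convex_core (ε : ℝ) : Convex ℝ (core X 𝒞 ε) := by
  refine (convex_marginalPolytope 𝒞).inter ?_
  intro v hv w hw a b ha hb hab k
  have h1 := mul_le_mul_of_nonneg_left (hv k) ha
  have h2 := mul_le_mul_of_nonneg_left (hw k) hb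
  have h3 : ε = a * ε + b * ε := by rw [← add_mul, hab, one_mul]
  simp only [PiLp.add_apply, PiLp.smul_apply, smul_eq_mul]
  linarith

lemma isCompact_core (ε : ℝ) : IsCompact (core X 𝒞 ε) := by
  refine (isCompact_marginalPolytope 𝒞).inter_right ?_
  have : {μ : Vec X 𝒞 | ∀ k, ε ≤ μ k} = ⋂ k, {μ : Vec X 𝒞 | ε ≤ μ k} := by ext; simp
  rw [this]
  exact isClosed_iInter fun k => isClosed_le continuous_const (by fun_prop)

lemma pos_of_mem_core {ε : ℝ} (hε : 0 < ε) {μ : Vec X 𝒞} (hμ : μ ∈ core X 𝒞 ε) (k : Idx X 𝒞) :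
    0 < μ k :=
  hε.trans_le (hμ.2 k)

lemma exists_suffStat_eq_one (hne : ∀ i, Nonempty (X i)) (k : Idx X 𝒞) :
    ∃ y : (i : V) → X i, suffStat 𝒞 y k = 1 := by
  rcases k with ⟨i, a⟩ | ⟨c, x⟩
  · exact ⟨Function.update (fun j => (hne j).some) i a, by simp [suffStat_inl]⟩
  · refine ⟨fun j => if h : j ∈ c.1 then x ⟨j, h⟩ else (hne j).some, ?_⟩
    rw [suffStat_inr, if_pos]
    ext j
    simp

/-- Marginals in the relative interior are positive. -/
lemma pos_of_mem_intrinsicInterior (hne : ∀ i, Nonempty (X i)) {μ : Vec X 𝒞}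
    (hμ : μ ∈ intrinsicInterior ℝ (marginalPolytope X 𝒞)) (k : Idx X 𝒞) : 0 < μ k := by
  obtain ⟨y, hy⟩ := exists_suffStat_eq_one hne k
  have hdir : suffStat 𝒞 y - μ ∈ (affineSpan ℝ (marginalPolytope X 𝒞)).direction :=
    AffineSubspace.vsub_mem_direction (subset_affineSpan ℝ _ (suffStat_mem y))
      (subset_affineSpan ℝ _ (intrinsicInterior_subset hμ))
  obtain ⟨r, hr, hball⟩ := Metric.eventually_nhds_iff.1
    (eventually_add_smul_mem_of_mem_intrinsicInterior hμ hdir)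
  -- Some vertex has `k`-th entry 1. Moving from `μ` slightly away from it stays in the polytope,
  -- which would make the entry negative if `μ k` were 0.
  have h := nonneg_of_mem (hball (y := -(r / 2)) (by
    rw [dist_zero_right, norm_neg, Real.norm_of_nonneg (by positivity)]
    exact half_lt_self hr)) k
  simp only [PiLp.add_apply, PiLp.smul_apply, PiLp.sub_apply, smul_eq_mul, hy] at h
  have h0 := nonneg_of_mem (intrinsicInterior_subset hμ) k
  nlinarith

lemma mem_intrinsicInterior_of_dist {δ : ℝ} (hδ : 0 < δ) {μ : Vec X 𝒞}
    (hμ : μ ∈ marginalPolytope X 𝒞)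
    (hdist : ∀ ν ∈ intrinsicFrontier ℝ (marginalPolytope X 𝒞), δ ≤ dist μ ν) :
    μ ∈ intrinsicInterior ℝ (marginalPolytope X 𝒞) := by
  rw [← intrinsicClosure_sdiff_intrinsicFrontier]
  refine ⟨subset_intrinsicClosure hμ, fun h => ?_⟩
  have := hdist μ h
  rw [dist_self] at this
  linarith

/-- Marginals away from the relative boundary are bounded away from zero. -/
lemma exists_mem_core_of_dist (hne : ∀ i, Nonempty (X i)) (𝒞 : Finset (Finset V)) {δ : ℝ}
    (hδ : 0 < δ) :
    ∃ ε > 0, ∀ μ ∈ marginalPolytope X 𝒞,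
      (∀ ν ∈ intrinsicFrontier ℝ (marginalPolytope X 𝒞), δ ≤ dist μ ν) → μ ∈ core X 𝒞 ε := by
  set S : Set (Vec X 𝒞) := marginalPolytope X 𝒞 ∩
    {μ | ∀ ν ∈ intrinsicFrontier ℝ (marginalPolytope X 𝒞), δ ≤ dist μ ν} with hS
  have hSc : IsCompact S := by
    refine (isCompact_marginalPolytope 𝒞).inter_right ?_
    simp only [Set.ofPred_forall]
    exact isClosed_biInter fun ν _ => isClosed_le continuous_const (by fun_prop)
  have hk : ∀ k : Idx X 𝒞, ∀ᶠ ε in nhdsWithin (0 : ℝ) (Set.Ioi 0), ∀ μ ∈ S, ε ≤ μ k := by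
    intro k
    rcases S.eq_empty_or_nonempty with h | h
    · simp [h]
    obtain ⟨μ, hμ, hmin⟩ := hSc.exists_isMinOn h
      (f := fun μ : Vec X 𝒞 => μ k) (by fun_prop)
    have hpos : 0 < μ k :=
      pos_of_mem_intrinsicInterior hne (mem_intrinsicInterior_of_dist hδ hμ.1 hμ.2) k
    filter_upwards [nhdsWithin_le_nhds (gt_mem_nhds hpos)] with ε hε ν hν
    exact hε.le.trans (hmin hν)
  obtain ⟨ε, hε, hpos⟩ := ((Filter.eventually_all.2 hk).and self_mem_nhdsWithin).exists
  exact ⟨ε, hpos, fun μ hμ hd => ⟨hμ, fun k => hε k μ ⟨hμ, hd⟩⟩⟩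

end Core

/-! ### Strong monotonicity and Lipschitz bounds for the Bethe gradient -/

section StrongConvexity

lemma betheQuad_smul (μ v : Vec X 𝒞) (r : ℝ) :
    betheQuad 𝒞 μ (r • v) = r ^ 2 * betheQuad 𝒞 μ v := by
  simp only [betheQuad, Finset.mul_sum, PiLp.smul_apply, smul_eq_mul]
  exact Finset.sum_congr rfl fun k _ => by ring

lemma isClosed_setOf_isConsistent (m : ℝ) : IsClosed {v : Vec X 𝒞 | IsConsistent 𝒞 m v} := by
  have : {v : Vec X 𝒞 | IsConsistent 𝒞 m v} =
      {v | ∀ i, ∑ a, v (Sum.inl ⟨i, a⟩) = m} ∩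
      {v | ∀ (c : {c : Finset V // c ∈ 𝒞}) (i : {i : V // i ∈ c.1}) (a : X i.1),
        (∑ x : ((i : {i : V // i ∈ c.1}) → X i.1), if x i = a then v (Sum.inr ⟨c, x⟩) else 0) =
        v (Sum.inl ⟨i.1, a⟩)} := by
    ext v
    exact ⟨fun h => ⟨h.1, h.2⟩, fun h => ⟨h.1, h.2⟩⟩
  rw [this]
  simp only [Set.ofPred_forall]
  refine (isClosed_iInter fun i => isClosed_eq (by fun_prop) (by fun_prop)).inter
    (isClosed_iInter fun c => isClosed_iInter fun i => isClosed_iInter fun a =>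
      isClosed_eq (continuous_finsetSum _ fun x _ => ?_) (by fun_prop))
  split_ifs <;> fun_prop

/-- The quadratic form of the Hessian is uniformly definite away from the boundary. -/
lemma exists_mul_norm_sq_le_betheQuad (hne : ∀ i, Nonempty (X i))
    (hconv : ConvexOn ℝ (marginalPolytope X 𝒞) fun μ => -betheEntropy 𝒞 μ) {ε : ℝ} (hε : 0 < ε) :
    ∃ σ > 0, ∀ μ ∈ core X 𝒞 ε, ∀ v : Vec X 𝒞, IsConsistent 𝒞 0 v →
      σ * ‖v‖ ^ 2 ≤ betheQuad 𝒞 μ v := by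
  obtain ⟨φ, hφ, hmem⟩ := exists_matching hne hconv
  -- By homogeneity in `v`, the minimum over base points and consistent unit directions serves as
  -- `σ`; it is positive by definiteness.
  set S : Set (Vec X 𝒞 × Vec X 𝒞) := core X 𝒞 ε ×ˢ
    (Metric.sphere 0 1 ∩ {v | IsConsistent 𝒞 0 v}) with hS
  have hSc : IsCompact S := (isCompact_core ε).prod
    ((isCompact_sphere _ _).inter_right (isClosed_setOf_isConsistent 0))
  have hcont : ContinuousOn (fun p : Vec X 𝒞 × Vec X 𝒞 => betheQuad 𝒞 p.1 p.2) S := by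
    refine continuousOn_finsetSum _ fun k _ => ContinuousOn.mul continuousOn_const ?_
    exact ContinuousOn.div (by fun_prop) (by fun_prop)
      fun p hp => (pos_of_mem_core hε hp.1 k).ne'
  obtain ⟨σ, hσ, hmin⟩ : ∃ σ > 0, ∀ p ∈ S, σ ≤ betheQuad 𝒞 p.1 p.2 := by
    rcases S.eq_empty_or_nonempty with h | h
    · exact ⟨1, one_pos, by simp [h]⟩
    obtain ⟨p, hp, hmin⟩ := hSc.exists_isMinOn h hcont
    refine ⟨_, ?_, fun q hq => hmin hq⟩
    by_contra! hle
    have h0 := eq_zero_of_betheQuad_nonpos hne hφ hmem (pos_of_mem_core hε hp.1)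
      (isConsistent_of_mem hp.1.1) hp.2.2 hle
    have h1 : ‖p.2‖ = 1 := by simpa using hp.2.1
    simp [h0] at h1
  refine ⟨σ, hσ, fun μ hμ v hv => ?_⟩
  rcases eq_or_ne v 0 with rfl | h0
  · simp [betheQuad]
  have hn : ‖v‖ ≠ 0 := norm_ne_zero_iff.2 h0
  have h1 := hmin (μ, ‖v‖⁻¹ • v) ⟨hμ, by simp [norm_smul, hn],
    by simpa using hv.combo (a := ‖v‖⁻¹) (b := 0) hv⟩
  have h2 : betheQuad 𝒞 μ v = ‖v‖ ^ 2 * betheQuad 𝒞 μ (‖v‖⁻¹ • v) := by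
    rw [betheQuad_smul]
    field_simp
  rw [h2, mul_comm]
  gcongr

/-- The gradient of the negative Bethe entropy is strongly monotone away from the boundary. -/
lemma mul_norm_sq_le_inner_betheGradient {ε σ : ℝ} (hε : 0 < ε)
    (hσ : ∀ μ ∈ core X 𝒞 ε, ∀ v : Vec X 𝒞, IsConsistent 𝒞 0 v → σ * ‖v‖ ^ 2 ≤ betheQuad 𝒞 μ v)
    {μ ν : Vec X 𝒞} (hμ : μ ∈ core X 𝒞 ε) (hν : ν ∈ core X 𝒞 ε) :
    σ * ‖μ - ν‖ ^ 2 ≤ inner ℝ (-betheGradient 𝒞 μ - -betheGradient 𝒞 ν) (μ - ν) := by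
  set v := μ - ν with hv
  have hvc : IsConsistent 𝒞 0 v := by
    simpa using (isConsistent_of_mem hμ.1).sub (isConsistent_of_mem hν.1)
  have hmem : ∀ s ∈ Set.Icc (0 : ℝ) 1, ν + s • v ∈ core X 𝒞 ε := fun s hs =>
    (convex_core ε).add_smul_sub_mem hν hμ hs
  have hd : ∀ s ∈ Set.Icc (0 : ℝ) 1,
      HasDerivAt (fun r : ℝ => inner ℝ (-betheGradient 𝒞 (ν + r • v)) v)
        (betheQuad 𝒞 (ν + s • v) v) s := by
    intro s hs
    have hfun : (fun r : ℝ => inner ℝ (-betheGradient 𝒞 (ν + r • v)) v) = fun r : ℝ =>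
        ∑ k, countingNumber 𝒞 k * (v k * (Real.log (ν k + r * v k) + 1)) := by
      funext r
      simp only [betheGradient, PiLp.inner_apply, PiLp.neg_apply, PiLp.add_apply, PiLp.smul_apply,
        smul_eq_mul, RCLike.inner_apply, conj_trivial]
      exact Finset.sum_congr rfl fun k _ => by ring
    rw [hfun]
    refine HasDerivAt.fun_sum fun k _ => HasDerivAt.const_mul _ ?_
    have hk : (ν + s • v) k ≠ 0 := (pos_of_mem_core hε (hmem s hs) k).ne'
    have h1 : HasDerivAt (fun r : ℝ => ν k + r * v k) (v k) s := by
      simpa using ((hasDerivAt_id s).mul_const (v k)).const_add (ν k)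
    convert ((h1.log hk).add_const 1).const_mul (v k) using 1
    simp only [PiLp.add_apply, PiLp.smul_apply, smul_eq_mul]
    ring
  obtain ⟨s, hs, h⟩ := exists_hasDerivAt_eq_slope _ _ one_pos
    (fun s hs => (hd s hs).continuousAt.continuousWithinAt)
    (fun s hs => hd s (Set.Ioo_subset_Icc_self hs))
  have h1 := hσ _ (hmem s (Set.Ioo_subset_Icc_self hs)) v hvc
  rw [h] at h1
  rw [inner_sub_left, inner_neg_left, inner_neg_left, hv]
  simp [hv] at h1
  linarith

lemma abs_log_sub_log_le {ε a b : ℝ} (hε : 0 < ε) (ha : ε ≤ a) (hb : ε ≤ b) :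
    |Real.log a - Real.log b| ≤ ε⁻¹ * |a - b| := by
  have key : ∀ a b : ℝ, ε ≤ a → ε ≤ b → Real.log a - Real.log b ≤ ε⁻¹ * |a - b| := by
    intro a b ha hb
    have ha0 := hε.trans_le ha
    have hb0 := hε.trans_le hb
    rw [← Real.log_div ha0.ne' hb0.ne']
    calc Real.log (a / b) ≤ a / b - 1 := Real.log_le_sub_one_of_pos (by positivity)
      _ = b⁻¹ * (a - b) := by field_simp
      _ ≤ b⁻¹ * |a - b| := by gcongr; exact le_abs_self _
      _ ≤ _ := by gcongr
  refine abs_le.2 ⟨?_, key a b ha hb⟩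
  have := key b a hb ha
  rw [abs_sub_comm] at this
  linarith

/-- The gradient of the Bethe entropy is Lipschitz away from the boundary. -/
lemma exists_norm_betheGradient_sub_le (X : V → Type*) [∀ i, Fintype (X i)]
    [∀ i, DecidableEq (X i)] (𝒞 : Finset (Finset V)) {ε : ℝ} (hε : 0 < ε) :
    ∃ ℓ > 0, ∀ μ ∈ core X 𝒞 ε, ∀ ν ∈ core X 𝒞 ε,
      ‖betheGradient 𝒞 μ - betheGradient 𝒞 ν‖ ≤ ℓ * ‖μ - ν‖ := by
  -- A crude bound for all counting numbers; the 1 keeps it positive even when they all vanish.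
  set W : ℝ := 1 + ∑ k : Idx X 𝒞, |countingNumber 𝒞 k| with hW
  have hW0 : 0 < W := by positivity
  refine ⟨W * ε⁻¹, by positivity, fun μ hμ ν hν => ?_⟩
  refine le_of_sq_le_sq ?_ (by positivity)
  rw [mul_pow, EuclideanSpace.real_norm_sq_eq, EuclideanSpace.real_norm_sq_eq, Finset.mul_sum]
  refine Finset.sum_le_sum fun k _ => ?_
  rw [← mul_pow, ← sq_abs, ← sq_abs (W * ε⁻¹ * _)]
  refine pow_le_pow_left₀ (abs_nonneg _) ?_ 2
  have h1 : (betheGradient 𝒞 μ - betheGradient 𝒞 ν) k =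
      -(countingNumber 𝒞 k * (Real.log (μ k) - Real.log (ν k))) := by
    simp only [betheGradient, PiLp.sub_apply]; ring
  have h2 : |countingNumber 𝒞 k| ≤ W := by
    have := Finset.single_le_sum (f := fun k : Idx X 𝒞 => |countingNumber 𝒞 k|)
      (fun k _ => abs_nonneg _) (Finset.mem_univ k)
    linarith
  rw [h1, abs_neg, abs_mul, abs_mul, abs_of_pos (by positivity : 0 < W * ε⁻¹), mul_assoc]
  exact mul_le_mul h2 (abs_log_sub_log_le hε (hμ.2 k) (hν.2 k)) (abs_nonneg _) hW0.le

end StrongConvexity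

/-! ### Gradients of the objective and optimality of the oracle call -/

section Gradients

variable {E : Type*} [NormedAddCommGroup E] [InnerProductSpace ℝ E] [CompleteSpace E]

lemma _root_.HasGradientAt.sub_inner {f : E → ℝ} {g x : E} (hf : HasGradientAt f g x) (θ : E) :
    HasGradientAt (fun z => f z - inner ℝ θ z) (g - θ) x := by
  rw [hasGradientAt_iff_hasFDerivAt, map_sub]
  exact hf.hasFDerivAt.sub (InnerProductSpace.toDual ℝ E θ).hasFDerivAt

lemma hasGradientAt_neg_betheEntropy {μ : Vec X 𝒞} (hμ : ∀ k, 0 < μ k) :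
    HasGradientAt (fun ν => -betheEntropy 𝒞 ν) (-betheGradient 𝒞 μ) μ := by
  rw [hasGradientAt_iff_hasFDerivAt, map_neg]
  exact (hasGradientAt_betheEntropy 𝒞 fun k => (hμ k).ne').hasFDerivAt.neg

lemma hasGradientAt_objective {θ : Vec X 𝒞} {L : Vec X 𝒞 → ℝ} {μ : Vec X 𝒞} (hμ : ∀ k, 0 < μ k)
    (hL : DifferentiableAt ℝ L μ) :
    HasGradientAt (objective 𝒞 θ L) (-betheGradient 𝒞 μ + (gradient L μ - θ)) μ := by
  have h : -betheGradient 𝒞 μ + (gradient L μ - θ) =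
    (-betheGradient 𝒞 μ - θ) + gradient L μ := by abel
  rw [h, hasGradientAt_iff_hasFDerivAt, map_add]
  exact ((hasGradientAt_neg_betheEntropy hμ).sub_inner θ).hasFDerivAt.add
    hL.hasGradientAt.hasFDerivAt

end Gradients

/-- The optimality condition of the oracle call in a step of Bethe-MD. -/
lemma IsBetheMD.starProjection_step_eq_zero {θ : Vec X 𝒞} {L : Vec X 𝒞 → ℝ} {η : ℕ → ℝ}
    {μ : ℕ → Vec X 𝒞} (h : IsBetheMD 𝒞 θ L η μ) {t : ℕ} (hη : 0 < η (t + 1))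
    (hint : μ (t + 1) ∈ intrinsicInterior ℝ (marginalPolytope X 𝒞)) (hpos : ∀ k, 0 < μ t k)
    (hpos' : ∀ k, 0 < μ (t + 1) k) :
    (affineSpan ℝ (marginalPolytope X 𝒞)).direction.starProjection
      ((1 + η (t + 1)) • (-betheGradient 𝒞 (μ (t + 1)) - -betheGradient 𝒞 (μ t)) +
        η (t + 1) • (-betheGradient 𝒞 (μ t) + (gradient L (μ t) - θ))) = 0 := by
  have hs := h.step t
  -- Positivity of the iterate ensures that `gradient` is the true gradient and not its default
  -- value 0.
  rw [(hasGradientAt_betheEntropy 𝒞 fun k => (hpos k).ne').gradient] at hs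
  have h0 := starProjection_gradient_eq_zero_of_isMinOn hint hs.2
    ((hasGradientAt_neg_betheEntropy hpos').sub_inner _)
  have h1 : (1 + η (t + 1)) * (1 / (1 + η (t + 1))) = 1 := by field_simp
  have h2 : (1 + η (t + 1)) • (-betheGradient 𝒞 (μ (t + 1)) - -betheGradient 𝒞 (μ t)) +
        η (t + 1) • (-betheGradient 𝒞 (μ t) + (gradient L (μ t) - θ)) =
      (1 + η (t + 1)) • (-betheGradient 𝒞 (μ (t + 1)) - (1 / (1 + η (t + 1))) •
        (η (t + 1) • θ - (betheGradient 𝒞 (μ t) + η (t + 1) • gradient L (μ t)))) := by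
    rw [smul_sub _ (-betheGradient 𝒞 (μ (t + 1))) ((1 / (1 + η (t + 1))) • _), smul_smul, h1]
    module
  rw [h2, map_smul, h0, smul_zero]

end BetheMD

end

/-! ### Proof of the proposition -/

open BetheMD

theorem mainTheorem5
    {V : Type*} [Fintype V] [DecidableEq V]
    {X : V → Type*} [∀ i, Fintype (X i)] [∀ i, DecidableEq (X i)]
    (𝒞 : Finset (Finset V))
    (hconv : ConvexOn ℝ (BetheMD.marginalPolytope X 𝒞) (fun μ => -BetheMD.betheEntropy 𝒞 μ))
    (Λ : ℝ≥0) (δ : ℝ) (hδ : 0 < δ) :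
    ∃ ηmax : ℝ, 0 < ηmax ∧
      ∀ (θ : BetheMD.Vec X 𝒞) (L : BetheMD.Vec X 𝒞 → ℝ) (η : ℕ → ℝ) (μ : ℕ → BetheMD.Vec X 𝒞),
        (∀ ν ∈ BetheMD.marginalPolytope X 𝒞, DifferentiableAt ℝ L ν) →
        LipschitzOnWith Λ (gradient L) (BetheMD.marginalPolytope X 𝒞) →
        (∀ t : ℕ, 1 ≤ t → 0 < η t ∧ η t ≤ ηmax) →
        Filter.Tendsto (fun T : ℕ => ∑ t ∈ Finset.Icc 1 T, η t) Filter.atTop Filter.atTop →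
        BetheMD.IsBetheMD 𝒞 θ L η μ →
        (∀ t : ℕ, ∀ ν ∈ intrinsicFrontier ℝ (BetheMD.marginalPolytope X 𝒞), δ ≤ dist (μ t) ν) →
        BetheMD.AsymptoticStationary (BetheMD.marginalPolytope X 𝒞)
          (BetheMD.objective 𝒞 θ L) μ := by
  -- The polytope is empty when some node has no state; then no run exists.
  rcases (marginalPolytope X 𝒞).eq_empty_or_nonempty with hM | hM
  · refine ⟨1, one_pos, fun θ L η μ _ _ _ _ hrun _ => ?_⟩
    have := hrun.init.1
    simp [hM] at this
  have hne : ∀ i, Nonempty (X i) := by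
    obtain ⟨_, y, rfl⟩ := convexHull_nonempty_iff.1 hM
    exact fun i => ⟨y i⟩
  obtain ⟨ε, hε, hcore⟩ := exists_mem_core_of_dist hne 𝒞 hδ
  obtain ⟨σ, hσ, hquad⟩ := exists_mul_norm_sq_le_betheQuad hne hconv hε
  obtain ⟨ℓ, hℓ, hlip⟩ := exists_norm_betheGradient_sub_le X 𝒞 hε
  -- This gives `η ≤ 1` and `Λη ≤ σ / 2`; `Λ + 1` avoids dividing by zero. Only `σ` enters, which
  -- depends on the model and, through `ε`, on `δ`.
  refine ⟨min 1 (σ / (2 * (Λ + 1))), by positivity,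
    fun θ L η μ hL hLlip hη hdiv hrun hdist => ?_⟩
  have hM : ∀ t, μ t ∈ marginalPolytope X 𝒞 := fun t => by
    cases t
    exacts [hrun.init.1, (hrun.step _).1]
  have hK : ∀ t, μ t ∈ core X 𝒞 ε := fun t => hcore _ (hM t) (hdist t)
  have hpos : ∀ t k, 0 < μ t k := fun t => pos_of_mem_core hε (hK t)
  have hobj : ∀ t, HasGradientAt (objective 𝒞 θ L)
      (-betheGradient 𝒞 (μ t) + (gradient L (μ t) - θ)) (μ t) := fun t =>
    hasGradientAt_objective (hpos t) (hL _ (hM t))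
  refine ⟨fun t => (hobj t).differentiableAt, ?_⟩
  simp only [gradientAlong, (hobj _).gradient]
  have hη' : ∀ t, 0 < η (t + 1) := fun t => (hη (t + 1) (by omega)).1
  have hηle : ∀ t, η (t + 1) ≤ min 1 (σ / (2 * (Λ + 1))) := fun t => (hη (t + 1) (by omega)).2
  -- The linear term `-⟨θ, ·⟩` is absorbed into the energy, whose Lipschitz constant it does not
  -- change. The rates are shifted by one, since `η 0` is not used.
  refine tendsto_gradient_of_mirrorDescent (f' := fun z => -betheGradient 𝒞 z)
    (L' := fun z => gradient L z - θ)
    (η := fun t => η (t + 1)) (convex_core ε) (isCompact_core ε) hσ hℓ Λ.2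
    (fun z hz => hasGradientAt_neg_betheEntropy (pos_of_mem_core hε hz))
    (fun z hz => (hL z hz.1).hasGradientAt.sub_inner θ)
    (fun x hx y hy => mul_norm_sq_le_inner_betheGradient hε hquad hx hy)
    (fun x hx y hy => ?_) (fun x hx y hy => ?_) hK (fun t => ?_) hη'
    (fun t => (hηle t).trans (min_le_left _ _)) (fun t => ?_) ?_ (fun t => ?_)
  · rw [← neg_sub', norm_neg]
    exact hlip x hx y hy
  · rw [sub_sub_sub_cancel_right]
    exact hLlip.norm_sub_le hx.1 hy.1
  · exact AffineSubspace.vsub_mem_direction (subset_affineSpan ℝ _ (hM _))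
      (subset_affineSpan ℝ _ (hM _))
  · calc (Λ : ℝ) * η (t + 1) ≤ (Λ + 1) * (σ / (2 * (Λ + 1))) :=
          mul_le_mul (by linarith) ((hηle t).trans (min_le_right _ _)) (hη' t).le (by positivity)
      _ = σ / 2 := by field_simp
  · rw [not_summable_iff_tendsto_nat_atTop_of_nonneg fun t => (hη' t).le]
    refine hdiv.congr fun T => ?_
    rw [Finset.range_eq_Ico, Finset.sum_Ico_add' η 0 T 1]
    rfl
  · exact hrun.starProjection_step_eq_zero (hη' t)
      (mem_intrinsicInterior_of_dist hδ (hM _) (hdist _)) (hpos t) (hpos (t + 1))
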